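/- Let $A_2=\mathbb C[t_1,t_2]$, $\partial_i=\partial/\partial t_i$, let $\bar S_2=\{p_1\partial_1+p_2\partial_2 : p_i\in A_2,\ \partial_1(p_1)+\partial_2(p_2)\in\mathbb C\}$ be the Lie algebra of polynomial vector fields with constant divergence, and let $\Delta_2=\mathrm{span}\{\partial_1,\partial_2\}$. Let $\Omega^{\bar S_2}_{\mathbf 0}$ be the category of $\bar S_2$-modules $M$ on which $\Delta_2$ acts locally finitely, on which every $x\in\Delta_2$ acts locally nilpotently, and for which the space $\mathrm{Wh}_{\mathbf 0}(M)=\{v\in M : xv=0\ \ \forall x\in\Delta_2\}$ is finite-dimensional. For a $\mathfrak{gl}_2$-module $V$ (over $\mathbb C$) let $T(A_2,V)=A_2\otimes V$ be the $\bar S_2$-module with $$D(p\otimes v)=D(p)\otimes v+\sum_{i,j=1}^{2}\partial_i(p_j)\,p\otimes E_{ij}v,\qquad D=p_1\partial_1+p_2\partial_2\in\bar S_2,\ p\in A_2,\ v\in V,$$ and let $T_1(A_2,V)$ be its $\bar S_2$-submodule generated by $V=1\otimes V$. Let $\bar S_2(0)=\mathrm{span}\{t_i\partial_j\}\cong\mathfrak{gl}_2$,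 $t_i\partial_j\mapsto E_{ij}$, and let $P(V)=U(\bar S_2)\otimes_{U(\Delta_2\oplus\bar S_2(0))}V$ be the parabolic Verma module, where $\bar S_2(0)$ acts on $V$ through this isomorphism and $\Delta_2V=0$. Proposition 4.1. (1) For every finite-dimensional simple $\mathfrak{gl}_2$-module $V$, the $\bar S_2$-module $T_1(A_2,V)$ is simple, $P(V)$ has a unique simple quotient $L(V)$ (that is, there is exactly one submodule $N$ with $P(V)/N$ simple), and $L(V)\cong T_1(A_2,V)$ as $\bar S_2$-modules. (2) If $M$ is a simple module in $\Omega^{\bar S_2}_{\mathbf 0}$, then there is a finite-dimensional simple $\mathfrak{gl}_2$-module $V$ such that $M\cong T_1(A_2,V)$ as $\bar S_2$-modules (and hence $M\cong L(V)$). -/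

import Mathlib

open scoped TensorProduct

-- Associative rings (matrices, enveloping algebras) carry the commutator bracket.
attribute [local instance 100] LieRing.ofAssociativeRing

universe u

namespace WhittakerS2

/-- The polynomial algebra `A₂ = ℂ[t₁, t₂]`; the variable `tᵢ` is `MvPolynomial.X i`. -/
abbrev A2 : Type := MvPolynomial (Fin 2) ℂ

/-- The Witt algebra `W₂` of derivations of `A₂`. -/
abbrev W2 : Type := Derivation ℂ A2 A2

/-- The Lie algebra `gl₂` of complex `2 × 2` matrices, with the commutator bracket. -/
abbrev gl2 : Type := Matrix (Fin 2) (Fin 2) ℂ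

/-- The Jacobian matrix of `D = ∑ pⱼ ∂ⱼ`: its `(i, j)` entry is `∂ᵢ(pⱼ)`, where `pⱼ = D(tⱼ)`. -/
noncomputable def jac (D : W2) : Matrix (Fin 2) (Fin 2) A2 :=
  Matrix.of fun i j => MvPolynomial.pderiv i (D (MvPolynomial.X j))

/-- The divergence of `D = ∑ pᵢ ∂ᵢ` is `∑ ∂ᵢ(pᵢ)`. -/
noncomputable def divergence (D : W2) : A2 :=
  ∑ i, MvPolynomial.pderiv i (D (MvPolynomial.X i))

theorem apply_eq_sum (D : W2) (f : A2) :
    D f = ∑ k, D (MvPolynomial.X k) * MvPolynomial.pderiv k f := by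
  have h : D = ∑ k, D (MvPolynomial.X k) • (MvPolynomial.pderiv k : W2) := by
    apply MvPolynomial.derivation_ext
    intro i
    fin_cases i <;> simp [Fin.sum_univ_two, Derivation.add_apply, MvPolynomial.pderiv_X]
  conv_lhs => rw [h]
  simp [Fin.sum_univ_two, Derivation.add_apply]

theorem pderiv_comm (i j : Fin 2) (f : A2) :
    MvPolynomial.pderiv i (MvPolynomial.pderiv j f) =
      MvPolynomial.pderiv j (MvPolynomial.pderiv i f) := by
  have h : ⁅(MvPolynomial.pderiv i : W2), (MvPolynomial.pderiv j : W2)⁆ = 0 := by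
    apply MvPolynomial.derivation_ext
    intro k
    simp [Derivation.commutator_apply, MvPolynomial.pderiv_X, Pi.single_apply, apply_ite]
  have h2 := congrArg (fun D : W2 => D f) h
  simpa [Derivation.commutator_apply, sub_eq_zero] using h2

theorem pderiv_apply (D : W2) (j : Fin 2) (f : A2) :
    MvPolynomial.pderiv j (D f) =
      D (MvPolynomial.pderiv j f) + ∑ k, jac D j k * MvPolynomial.pderiv k f := by
  rw [apply_eq_sum D f, apply_eq_sum D (MvPolynomial.pderiv j f)]
  simp only [Fin.sum_univ_two, map_add, Derivation.leibniz, smul_eq_mul, jac, Matrix.of_apply,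
    pderiv_comm j]
  ring

theorem jac_add (D E : W2) : jac (D + E) = jac D + jac E := by
  ext1 i j; simp [jac]

theorem jac_smul (c : ℂ) (D : W2) : jac (c • D) = c • jac D := by
  ext1 i j; simp [jac]

theorem jac_lie (D E : W2) (i j : Fin 2) :
    jac ⁅D, E⁆ i j = D (jac E i j) - E (jac D i j)
      + ∑ k, (jac D i k * jac E k j - jac E i k * jac D k j) := by
  have h : jac ⁅D, E⁆ i j = MvPolynomial.pderiv i (D (E (MvPolynomial.X j)))
      - MvPolynomial.pderiv i (E (D (MvPolynomial.X j))) := by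
    simp [jac, Derivation.commutator_apply]
  rw [h, pderiv_apply D, pderiv_apply E i (D (MvPolynomial.X j))]
  simp only [Fin.sum_univ_two, jac, Matrix.of_apply]
  ring

theorem divergence_eq (D : W2) : divergence D = jac D 0 0 + jac D 1 1 := by
  simp [divergence, jac, Fin.sum_univ_two]

/-- The Lie algebra `S̄₂` of polynomial vector fields with constant divergence. -/
noncomputable def S2bar : LieSubalgebra ℂ W2 where
  carrier := {D | ∃ c : ℂ, divergence D = MvPolynomial.C c}
  add_mem' := by
    rintro D E ⟨c, hc⟩ ⟨c', hc'⟩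
    refine ⟨c + c', ?_⟩
    rw [map_add, ← hc, ← hc']
    simp only [divergence_eq, jac_add, Matrix.add_apply]
    ring
  zero_mem' := ⟨0, by simp [divergence]⟩
  smul_mem' := by
    rintro a D ⟨c, hc⟩
    refine ⟨a * c, ?_⟩
    rw [map_mul, ← hc]
    simp only [divergence_eq, jac_smul, Matrix.smul_apply, MvPolynomial.smul_eq_C_mul]
    ring
  lie_mem' := by
    rintro D E ⟨c, hc⟩ ⟨c', hc'⟩
    refine ⟨0, ?_⟩
    have h1 : D (divergence E) = 0 := by rw [hc', MvPolynomial.derivation_C]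
    have h2 : E (divergence D) = 0 := by rw [hc, MvPolynomial.derivation_C]
    rw [divergence_eq, map_add] at h1 h2
    rw [divergence_eq, jac_lie, jac_lie, map_zero]
    simp only [Fin.sum_univ_two]
    linear_combination h1 - h2

/-- The partial derivative `∂ᵢ` as an element of `S̄₂`. -/
noncomputable def del (i : Fin 2) : S2bar :=
  ⟨MvPolynomial.pderiv i, 0, by
    fin_cases i <;> simp [divergence, Fin.sum_univ_two, MvPolynomial.pderiv_X]⟩

/-- `Δ₂ = span {∂₁, ∂₂}`. -/
noncomputable def Delta2 : Submodule ℂ S2bar := Submodule.span ℂ (Set.range del)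

/-- The linear functional `φ_a` on `Δ₂` with `φ_a(∂ᵢ) = aᵢ`: the coefficient of `∂ᵢ` in
`x ∈ Δ₂` is the constant polynomial `x(tᵢ)`. -/
noncomputable def phi (a : Fin 2 → ℂ) : Delta2 →ₗ[ℂ] ℂ where
  toFun x := ∑ i, a i * MvPolynomial.constantCoeff ((x : S2bar).1 (MvPolynomial.X i))
  map_add' x y := by simp [Fin.sum_univ_two]; ring
  map_smul' c x := by simp [Fin.sum_univ_two, MvPolynomial.smul_eq_C_mul]; ring

theorem phi_del (a : Fin 2 → ℂ) (i : Fin 2) :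
    phi a ⟨del i, Submodule.subset_span ⟨i, rfl⟩⟩ = a i := by
  fin_cases i <;> simp [phi, del, Fin.sum_univ_two, MvPolynomial.pderiv_X]

section Whittaker

variable (M : Type*) [AddCommGroup M] [Module ℂ M] [LieRingModule S2bar M] [LieModule ℂ S2bar M]

/-- The space `Wh_a(M)` of Whittaker vectors: `x v = φ_a(x) v` for all `x ∈ Δ₂`. -/
noncomputable def Wh (a : Fin 2 → ℂ) : Submodule ℂ M where
  carrier := {v | ∀ x : Delta2, ⁅(x : S2bar), v⁆ = phi a x • v}
  add_mem' := by
    intro v w hv hw x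
    rw [lie_add, hv x, hw x, smul_add]
  zero_mem' := by
    intro x
    rw [lie_zero, smul_zero]
  smul_mem' := by
    intro c v hv x
    rw [lie_smul, hv x, smul_comm]

/-- `M` is a Whittaker module: `Δ₂` acts locally finitely. -/
def IsWhittaker : Prop :=
  ∀ v : M, ∃ W : Submodule ℂ M, FiniteDimensional ℂ W ∧ v ∈ W ∧
    ∀ x : Delta2, ∀ w ∈ W, ⁅(x : S2bar), w⁆ ∈ W

/-- `M` is of type `φ_a`: every `x - φ_a(x)`, `x ∈ Δ₂`, acts locally nilpotently on `M`. -/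
def IsOfType (a : Fin 2 → ℂ) : Prop :=
  ∀ (v : M) (x : Delta2), ∃ k : ℕ,
    ((LieModule.toEnd ℂ S2bar M x - phi a x • (1 : Module.End ℂ M)) ^ k) v = 0

/-- `M` is an object of `Ω_a`: a Whittaker `S̄₂`-module of type `φ_a` whose space of Whittaker
vectors is finite-dimensional. -/
structure InOmega (a : Fin 2 → ℂ) : Prop where
  isWhittaker : IsWhittaker M
  isOfType : IsOfType M a
  finiteDimensional : FiniteDimensional ℂ (Wh M a)

end Whittaker

/-- The underlying space `A₂ ⊗ V` of the tensor module `T(A₂, V)`. -/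
def T (V : Type u) [AddCommGroup V] [Module ℂ V] : Type u := A2 ⊗[ℂ] V

section Tensor

variable (V : Type u) [AddCommGroup V] [Module ℂ V]

noncomputable instance : AddCommGroup (T V) := inferInstanceAs (AddCommGroup (A2 ⊗[ℂ] V))
noncomputable instance : Module ℂ (T V) := inferInstanceAs (Module ℂ (A2 ⊗[ℂ] V))

variable [LieRingModule gl2 V] [LieModule ℂ gl2 V]

/-- The action of the vector field `D` on `T(A₂, V) = A₂ ⊗ V`:
`D (p ⊗ v) = D(p) ⊗ v + ∑ᵢⱼ ∂ᵢ(D(tⱼ)) p ⊗ Eᵢⱼ v`. -/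
noncomputable def tensorAct (D : W2) : A2 ⊗[ℂ] V →ₗ[ℂ] A2 ⊗[ℂ] V :=
  TensorProduct.map (D : A2 →ₗ[ℂ] A2) LinearMap.id +
    ∑ i, ∑ j, TensorProduct.map (LinearMap.mulLeft ℂ (jac D i j))
      (LieModule.toEnd ℂ gl2 V (Matrix.single i j 1))

variable {V}

theorem tensorAct_tmul (D : W2) (p : A2) (v : V) :
    tensorAct V D (p ⊗ₜ v) =
      D p ⊗ₜ v + ∑ i, ∑ j, (jac D i j * p) ⊗ₜ ⁅(Matrix.single i j 1 : gl2), v⁆ := by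
  simp [tensorAct]

theorem tensorAct_add (D E : W2) : tensorAct V (D + E) = tensorAct V D + tensorAct V E := by
  refine TensorProduct.ext' fun p v => ?_
  simp only [LinearMap.add_apply, tensorAct_tmul, jac_add, Fin.sum_univ_two,
    Derivation.add_apply, Matrix.add_apply, add_mul, TensorProduct.add_tmul]
  abel

theorem tensorAct_smul (c : ℂ) (D : W2) : tensorAct V (c • D) = c • tensorAct V D := by
  refine TensorProduct.ext' fun p v => ?_
  simp only [LinearMap.smul_apply, tensorAct_tmul, jac_smul, Fin.sum_univ_two,
    Derivation.smul_apply, Matrix.smul_apply, smul_mul_assoc, TensorProduct.smul_tmul', smul_add]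

theorem single_lie (i j k l : Fin 2) (v : V) :
    ⁅(Matrix.single i j 1 : gl2), ⁅(Matrix.single k l 1 : gl2), v⁆⁆ =
      ⁅(Matrix.single k l 1 : gl2), ⁅(Matrix.single i j 1 : gl2), v⁆⁆
      + ((if j = k then ⁅(Matrix.single i l 1 : gl2), v⁆ else 0)
        - (if l = i then ⁅(Matrix.single k j 1 : gl2), v⁆ else 0)) := by
  rw [leibniz_lie, LieRing.of_associative_ring_bracket, add_comm]
  congr 1
  rw [sub_lie]
  congr 1
  · split_ifs with h
    · subst h; simp
    · rw [Matrix.single_mul_single_of_ne (h := h), zero_lie]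
  · split_ifs with h
    · subst h; simp
    · rw [Matrix.single_mul_single_of_ne (h := h), zero_lie]

theorem tensorAct_lie (D E : W2) (w : A2 ⊗[ℂ] V) :
    tensorAct V ⁅D, E⁆ w =
      tensorAct V D (tensorAct V E w) - tensorAct V E (tensorAct V D w) := by
  induction w using TensorProduct.induction_on with
  | zero => simp
  | add x y hx hy => simp only [map_add, hx, hy]; abel
  | tmul p v =>
    have key : ∀ (q : A2) (u : V), q ⊗ₜ[ℂ] u = q • ((1 : A2) ⊗ₜ[ℂ] u) := by
      intro q u
      rw [TensorProduct.smul_tmul', smul_eq_mul, mul_one]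
    have h := single_lie (V := V)
    simp only [tensorAct_tmul, map_add, Fin.sum_univ_two, jac_lie, Derivation.commutator_apply,
      Derivation.leibniz, smul_eq_mul]
    rw [h 0 1 0 0, h 1 0 0 0, h 1 0 0 1, h 1 1 0 0, h 1 1 0 1, h 1 1 1 0]
    simp only [Fin.isValue, if_true, if_false, zero_ne_one, one_ne_zero,
      TensorProduct.tmul_add, TensorProduct.tmul_sub, TensorProduct.tmul_zero]
    simp only [key (_ + _), key (_ - _), key (_ * _), key (D _), key (E _)]
    module

noncomputable instance : LieRingModule S2bar (T V) where
  bracket D w := tensorAct V D.1 w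
  add_lie D E w := LinearMap.congr_fun (tensorAct_add D.1 E.1) w
  lie_add D w w' := map_add (tensorAct V D.1) w w'
  leibniz_lie D E w := by
    have h := tensorAct_lie D.1 E.1 w
    exact (sub_eq_iff_eq_add.mp h.symm)

noncomputable instance : LieModule ℂ S2bar (T V) where
  smul_lie c D w := LinearMap.congr_fun (tensorAct_smul c D.1) w
  lie_smul c D w := map_smul (tensorAct V D.1) c w

variable (V)

/-- `T₁(A₂, V)`: the `S̄₂`-submodule of `T(A₂, V)` generated by `V = 1 ⊗ V`. -/
noncomputable def T1 : LieSubmodule ℂ S2bar (T V) :=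
  LieSubmodule.lieSpan ℂ S2bar (Set.range fun v : V => ((1 : A2) ⊗ₜ[ℂ] v : A2 ⊗[ℂ] V))

end Tensor

/-- The parabolic subalgebra `Δ₂ ⊕ S̄₂(0)`, spanned by the `∂ᵢ` and the `tᵢ ∂ⱼ`: it consists of
the vector fields with affine coefficients, i.e. with constant Jacobian matrix. -/
noncomputable def parabolic : LieSubalgebra ℂ S2bar where
  carrier := {D | ∃ a : gl2, ∀ i j, jac D.1 i j = MvPolynomial.C (a i j)}
  add_mem' := by
    rintro D E ⟨a, ha⟩ ⟨b, hb⟩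
    exact ⟨a + b, fun i j => by simp [jac_add, ha, hb]⟩
  zero_mem' := ⟨0, fun i j => by simp [jac]⟩
  smul_mem' := by
    rintro c D ⟨a, ha⟩
    exact ⟨c • a, fun i j => by simp [jac_smul, ha, MvPolynomial.smul_eq_C_mul]⟩
  lie_mem' := by
    rintro D E ⟨a, ha⟩ ⟨b, hb⟩
    refine ⟨⁅a, b⁆, fun i j => ?_⟩
    rw [LieSubalgebra.coe_bracket, jac_lie]
    simp only [ha, hb, MvPolynomial.derivation_C, Fin.sum_univ_two,
      LieRing.of_associative_ring_bracket, Matrix.sub_apply, Matrix.mul_apply, map_sub, map_add,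
      map_mul]
    ring

/-- The projection `Δ₂ ⊕ S̄₂(0) → S̄₂(0) ≅ gl₂`, killing `Δ₂` and sending `tᵢ ∂ⱼ` to `Eᵢⱼ`;
it is the (constant) Jacobian matrix. -/
noncomputable def levi : parabolic →ₗ⁅ℂ⁆ gl2 where
  toFun D := Matrix.of fun i j => MvPolynomial.constantCoeff (jac D.1.1 i j)
  map_add' D E := by ext i j; simp [jac_add]
  map_smul' c D := by ext i j; simp [jac_smul, MvPolynomial.smul_eq_C_mul]
  map_lie' := by
    rintro ⟨D, a, ha⟩ ⟨E, b, hb⟩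
    ext i j
    simp only [LieSubalgebra.coe_bracket, Matrix.of_apply, jac_lie,
      LieRing.of_associative_ring_bracket, Matrix.sub_apply, Matrix.mul_apply]
    simp only [ha, hb, MvPolynomial.derivation_C, Fin.sum_univ_two, map_sub, map_add, map_mul,
      map_zero, MvPolynomial.constantCoeff_C]
    ring

/-- The enveloping algebra `U(S̄₂)`. -/
abbrev US2 : Type := UniversalEnvelopingAlgebra ℂ S2bar

section Verma

variable (V : Type u) [AddCommGroup V] [Module ℂ V] [LieRingModule gl2 V] [LieModule ℂ gl2 V]

/-- The left `U(S̄₂)`-submodule of `U(S̄₂) ⊗_ℂ V` by which one divides to obtain the tensor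
product over `U(Δ₂ ⊕ S̄₂(0))`. -/
noncomputable def vermaRel : Submodule US2 (US2 ⊗[ℂ] V) :=
  Submodule.span US2 {w | ∃ (x : parabolic) (v : V),
    w = UniversalEnvelopingAlgebra.ι ℂ (x : S2bar) ⊗ₜ v - 1 ⊗ₜ ⁅levi x, v⁆}

/-- The parabolic Verma module `U(S̄₂) ⊗_{U(Δ₂ ⊕ S̄₂(0))} V`, where `S̄₂(0) ≅ gl₂` acts on `V` as
given and `Δ₂ V = 0`. -/
def ParabolicVerma : Type u := (US2 ⊗[ℂ] V) ⧸ vermaRel V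

noncomputable instance : AddCommGroup (ParabolicVerma V) :=
  inferInstanceAs (AddCommGroup ((US2 ⊗[ℂ] V) ⧸ vermaRel V))
noncomputable instance : Module US2 (ParabolicVerma V) :=
  inferInstanceAs (Module US2 ((US2 ⊗[ℂ] V) ⧸ vermaRel V))
noncomputable instance : Module ℂ (ParabolicVerma V) :=
  inferInstanceAs (Module ℂ ((US2 ⊗[ℂ] V) ⧸ vermaRel V))
instance : IsScalarTower ℂ US2 (ParabolicVerma V) :=
  inferInstanceAs (IsScalarTower ℂ US2 ((US2 ⊗[ℂ] V) ⧸ vermaRel V))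

noncomputable instance : LieRingModule S2bar (ParabolicVerma V) where
  bracket x m := UniversalEnvelopingAlgebra.ι ℂ x • m
  add_lie x y m := by
    change UniversalEnvelopingAlgebra.ι ℂ (x + y) • m = _
    rw [map_add, add_smul]
  lie_add x m n := smul_add _ m n
  leibniz_lie x y m := by
    change UniversalEnvelopingAlgebra.ι ℂ x • UniversalEnvelopingAlgebra.ι ℂ y • m =
      UniversalEnvelopingAlgebra.ι ℂ ⁅x, y⁆ • m +
        UniversalEnvelopingAlgebra.ι ℂ y • UniversalEnvelopingAlgebra.ι ℂ x • m
    rw [LieHom.map_lie, LieRing.of_associative_ring_bracket, sub_smul, mul_smul, mul_smul,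
      sub_add_cancel]

instance : LieModule ℂ S2bar (ParabolicVerma V) where
  smul_lie c x m := by
    change UniversalEnvelopingAlgebra.ι ℂ (c • x) • m = c • UniversalEnvelopingAlgebra.ι ℂ x • m
    rw [map_smul, smul_assoc]
  lie_smul c x m := by
    change UniversalEnvelopingAlgebra.ι ℂ x • c • m = c • UniversalEnvelopingAlgebra.ι ℂ x • m
    rw [← smul_assoc c, ← algebraMap_smul US2 c m, smul_smul, ← Algebra.commutes,
      ← Algebra.smul_def]

end Verma

end WhittakerS2

set_option linter.unusedSectionVars false

namespace WhittakerS2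

/-! Everything is controlled by the Euler field `e = t₁∂₁ + t₂∂₂`, the image of the identity matrix.
On a simple finite-dimensional `V` it acts by a scalar `c`, and `ad e` splits `S̄₂` into the affine
fields and eigenvectors of positive integral eigenvalue (`S2bar_eq_parabolic_sup`). So a module
generated by the image of a `gl₂`-map `f` from `V` killed by `Δ₂` is `f(V)` plus `e`-eigenspaces of
eigenvalues `c + 1, c + 2, …` (`range_sup_upper`). A polynomial in `e` isolates the `f(V)`-part of
any vector, and a submodule containing a nonzero such part is everything. Hence all proper
submodules lie in the one proper subspace `upper`, and there is at most one maximal submodule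
(`isCoatom_unique`). This applies to `P(V)` without the Poincaré–Birkhoff–Witt theorem.

On `T(A₂, V)` the `∂ᵢ` commute and are locally nilpotent, so a nonzero submodule contains a nonzero
vector killed by both. Such vectors form `1 ⊗ V`, whence `T₁(A₂, V)` is simple (`isIrreducible_T1`).
The universal property of `P(V)` makes it a simple quotient, hence the only one.

For a simple `M` in the category, the same nilpotency argument gives `Wh₀(M) ≠ 0`. This is a
finite-dimensional `gl₂`-module; a simple submodule `K` generates `M`, so `M` is a simple quotient
of `P(K)`, and uniqueness identifies it with `T₁(A₂, K)`. -/

theorem W2_ext {D E : W2} (h : ∀ j, D (MvPolynomial.X j) = E (MvPolynomial.X j)) : D = E :=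
  MvPolynomial.derivation_ext h

/-! ### Constant, linear and affine vector fields -/

/-- The vector field `∑ pⱼ ∂ⱼ`. -/
noncomputable def vectorField (p : Fin 2 → A2) : W2 := ∑ j, p j • MvPolynomial.pderiv j

@[simp] theorem vectorField_X (p : Fin 2 → A2) (j : Fin 2) :
    vectorField p (MvPolynomial.X j) = p j := by
  fin_cases j <;>
    simp [vectorField, Fin.sum_univ_two, Derivation.add_apply, MvPolynomial.pderiv_X]

theorem jac_vectorField (p : Fin 2 → A2) (i j : Fin 2) :
    jac (vectorField p) i j = MvPolynomial.pderiv i (p j) := by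
  simp [jac]

/-- The linear vector field `∑ aᵢⱼ tᵢ ∂ⱼ` attached to a matrix. -/
noncomputable def linearField (a : gl2) : W2 :=
  vectorField fun j => ∑ i, MvPolynomial.C (a i j) * MvPolynomial.X i

theorem jac_linearField (a : gl2) (i j : Fin 2) :
    jac (linearField a) i j = MvPolynomial.C (a i j) := by
  rw [linearField, jac_vectorField]
  fin_cases i <;> simp [Fin.sum_univ_two, MvPolynomial.pderiv_X]

theorem linearField_X (a : gl2) (j : Fin 2) :
    linearField a (MvPolynomial.X j) = ∑ i, MvPolynomial.C (a i j) * MvPolynomial.X i := by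
  simp [linearField]

/-- The embedding of `gl₂` in `S̄₂` as the algebra of linear vector fields. -/
noncomputable def linear : gl2 →ₗ⁅ℂ⁆ S2bar where
  toFun a := ⟨linearField a, a 0 0 + a 1 1, by simp [divergence_eq, jac_linearField]⟩
  map_add' a b := Subtype.ext <| W2_ext fun j => by
    simp [linearField_X, Fin.sum_univ_two]; ring
  map_smul' c a := Subtype.ext <| W2_ext fun j => by
    simp [linearField_X, Fin.sum_univ_two, MvPolynomial.smul_eq_C_mul]; ring
  map_lie' {a b} := Subtype.ext <| W2_ext fun j => by
    simp [linearField_X, Fin.sum_univ_two, Derivation.commutator_apply,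
      LieRing.of_associative_ring_bracket, Matrix.mul_apply]
    ring

theorem coe_linear (a : gl2) : (linear a : W2) = linearField a := rfl

/-- The Euler vector field `∑ tᵢ ∂ᵢ`. -/
noncomputable def euler : S2bar := linear 1

theorem linear_mem_parabolic (a : gl2) : linear a ∈ parabolic := ⟨a, jac_linearField a⟩

theorem levi_linear (a : gl2) : levi ⟨linear a, linear_mem_parabolic a⟩ = a := by
  ext i j
  simp [levi, coe_linear, jac_linearField]

theorem coe_del (i : Fin 2) : (del i : W2) = MvPolynomial.pderiv i := rfl

theorem jac_del (i : Fin 2) : jac (del i : W2) = 0 := by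
  ext1 k j
  fin_cases i <;> fin_cases j <;> simp [jac, coe_del, MvPolynomial.pderiv_X]

/-- In characteristic zero a monomial with `m i ≠ 0` survives `∂ᵢ`: its coefficient reappears
multiplied by the nonzero number `m i`. -/
theorem eq_C_of_pderiv_eq_zero {p : A2} (h : ∀ i, MvPolynomial.pderiv i p = 0) :
    p = MvPolynomial.C (MvPolynomial.constantCoeff p) := by
  ext m
  rw [MvPolynomial.coeff_C]
  split_ifs with hm
  · rw [← hm, MvPolynomial.constantCoeff_eq]
  · obtain ⟨i, hi⟩ : ∃ i, m i ≠ 0 := by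
      by_contra! hc
      exact hm (Finsupp.ext fun i => (hc i).symm)
    have h1 := congrArg (MvPolynomial.coeff (m - Finsupp.single i 1)) (h i)
    have h2 : m - Finsupp.single i 1 + Finsupp.single i 1 = m := by
      apply tsub_add_cancel_of_le
      simpa [Finsupp.single_le_iff] using Nat.one_le_iff_ne_zero.mpr hi
    rw [MvPolynomial.coeff_pderiv, h2, MvPolynomial.coeff_zero] at h1
    rcases mul_eq_zero.mp h1 with h3 | h3
    · exact h3
    · exact absurd h3 (Nat.cast_add_one_ne_zero _)

/-- An affine vector field is the sum of a constant one and its linear part. -/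
theorem parabolic_eq (x : parabolic) :
    ∃ b : Fin 2 → ℂ, (x : S2bar) = ∑ i, b i • del i + linear (levi x) := by
  obtain ⟨a, ha⟩ := x.2
  have hl : levi x = a := by ext i j; simp [levi, ha]
  -- Subtracting the linear field with the same Jacobian leaves coefficients with zero gradient,
  -- that is, constants.
  have key : ∀ j, ∃ c : ℂ, x.1.1 (MvPolynomial.X j) - linearField a (MvPolynomial.X j)
      = MvPolynomial.C c := fun j => ⟨_, eq_C_of_pderiv_eq_zero fun i => by
    rw [map_sub]
    have h1 := ha i j
    rw [← jac_linearField a i j] at h1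
    simpa [jac, sub_eq_zero] using h1⟩
  choose b hb using key
  refine ⟨b, Subtype.ext <| W2_ext fun j => ?_⟩
  rw [hl]
  have := hb j
  rw [sub_eq_iff_eq_add] at this
  rw [this]
  fin_cases j <;>
    simp [Fin.sum_univ_two, coe_del, coe_linear, MvPolynomial.pderiv_X,
      MvPolynomial.smul_eq_C_mul]

theorem del_lie_linear (i : Fin 2) (a : gl2) : ⁅del i, linear a⁆ = ∑ j, a i j • del j := by
  refine Subtype.ext <| W2_ext fun k => ?_
  fin_cases i <;> fin_cases k <;>
  simp [Fin.sum_univ_two, coe_del, coe_linear, linearField_X, Derivation.commutator_apply,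
    MvPolynomial.pderiv_X, MvPolynomial.smul_eq_C_mul]

theorem del_lie_del (i j : Fin 2) : ⁅del i, del j⁆ = 0 := by
  refine Subtype.ext <| W2_ext fun k => ?_
  simp [coe_del, Derivation.commutator_apply, pderiv_comm i j (MvPolynomial.X k), -MvPolynomial.pderiv_X]

/-! ### Grading of `S̄₂` by the Euler field -/

/-- The component of a vector field whose coefficients are homogeneous of degree `n`. -/
noncomputable def component (n : ℕ) (D : W2) : W2 :=
  vectorField fun j => MvPolynomial.homogeneousComponent n (D (MvPolynomial.X j))

theorem pderiv_homogeneousComponent (n : ℕ) (i : Fin 2) (p : A2) :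
    MvPolynomial.pderiv i (MvPolynomial.homogeneousComponent (n + 1) p) =
      MvPolynomial.homogeneousComponent n (MvPolynomial.pderiv i p) := by
  ext m
  simp only [MvPolynomial.coeff_pderiv, MvPolynomial.coeff_homogeneousComponent, map_add,
    Finsupp.degree_single, add_left_inj]
  split_ifs <;> simp

/-- Divergence lowers degree by one, so it carries components to components, and every component of
a constant is constant. -/
theorem component_mem (n : ℕ) {D : W2} (hD : D ∈ S2bar) : component n D ∈ S2bar := by
  obtain ⟨c, hc⟩ := hD
  cases n with
  | zero => exact ⟨0, by
      simp [divergence, component, MvPolynomial.homogeneousComponent_zero]⟩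
  | succ n =>
    have h : divergence (component (n + 1) D)
        = MvPolynomial.homogeneousComponent n (divergence D) := by
      simp [divergence, component, pderiv_homogeneousComponent]
    refine ⟨if n = 0 then c else 0, ?_⟩
    rw [h, hc]
    ext m
    rw [MvPolynomial.coeff_homogeneousComponent]
    by_cases hm : m = 0
    · subst hm; by_cases hn : n = 0 <;> simp [hn, eq_comm]
    · simp [MvPolynomial.coeff_C, Ne.symm hm]

theorem euler_apply_homogeneousComponent (n : ℕ) (p : A2) :
    (euler : W2) (MvPolynomial.homogeneousComponent n p) =
      (n : ℂ) • MvPolynomial.homogeneousComponent n p := by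
  have h := (MvPolynomial.homogeneousComponent_isHomogeneous n p).sum_X_mul_pderiv
  rw [apply_eq_sum]
  have hX : ∀ k, (euler : W2) (MvPolynomial.X k) = MvPolynomial.X k := fun k => by
    fin_cases k <;> simp [euler, coe_linear, linearField_X, Fin.sum_univ_two]
  simp only [hX]
  rw [h, Nat.cast_smul_eq_nsmul]

/-- The shift by one comes from `∂ⱼ`, which has degree `-1`. -/
theorem euler_lie_component (n : ℕ) (D : W2) :
    ⁅(euler : W2), component n D⁆ = ((n : ℂ) - 1) • component n D := by
  refine W2_ext fun k => ?_
  have hX : (euler : W2) (MvPolynomial.X k) = MvPolynomial.X k := by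
    fin_cases k <;> simp [euler, coe_linear, linearField_X, Fin.sum_univ_two]
  rw [Derivation.commutator_apply, hX]
  simp [component, euler_apply_homogeneousComponent, sub_smul]

theorem sum_derivation_apply (s : Finset ℕ) (g : ℕ → W2) (p : A2) :
    (∑ n ∈ s, g n) p = ∑ n ∈ s, g n p := by
  induction s using Finset.cons_induction with
  | empty => simp
  | cons n s hn ih => rw [Finset.sum_cons, Finset.sum_cons, Derivation.add_apply, ih]

theorem exists_sum_component (D : W2) : ∃ N, D = ∑ n ∈ Finset.range N, component n D := by
  -- The sum of the two degrees bounds both coefficients at once.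
  refine ⟨(D (MvPolynomial.X 0)).totalDegree + (D (MvPolynomial.X 1)).totalDegree + 1,
    W2_ext fun j => ?_⟩
  rw [sum_derivation_apply]
  simp only [component, vectorField_X]
  conv_lhs => rw [← MvPolynomial.sum_homogeneousComponent (D (MvPolynomial.X j))]
  refine Finset.sum_subset ?_ fun n _ hn => ?_
  · intro n
    simp only [Finset.mem_range]
    fin_cases j <;> simp <;> omega
  · refine MvPolynomial.homogeneousComponent_eq_zero _ _ ?_
    simpa [Nat.lt_succ_iff] using hn

/-- `S̄₂` is spanned by the affine vector fields and eigenvectors of `ad` of the Euler field with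
positive integral eigenvalue. -/
theorem S2bar_eq_parabolic_sup (x : S2bar) :
    x ∈ parabolic.toSubmodule ⊔
      Submodule.span ℂ {y : S2bar | ∃ n : ℕ, ⁅euler, y⁆ = ((n : ℂ) + 1) • y} := by
  set S := parabolic.toSubmodule ⊔
      Submodule.span ℂ {y : S2bar | ∃ n : ℕ, ⁅euler, y⁆ = ((n : ℂ) + 1) • y} with hS
  let c : ℕ → S2bar := fun n => ⟨component n x.1, component_mem n x.2⟩
  have hc : ∀ n, c n ∈ S := fun n => by
    -- Degrees 0 and 1 give affine fields; degree `n ≥ 2` gives eigenvalue `n - 1 = (n - 2) + 1`.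
    rcases lt_or_ge n 2 with hn | hn
    · refine le_sup_left (a := parabolic.toSubmodule) (b := Submodule.span ℂ _) ?_
      refine ⟨Matrix.of fun i j => MvPolynomial.constantCoeff (jac (c n).1 i j), fun i j => ?_⟩
      change jac (component n x.1) i j = MvPolynomial.C (MvPolynomial.constantCoeff
        (jac (component n x.1) i j))
      rw [component, jac_vectorField]
      interval_cases n
      · simp [MvPolynomial.homogeneousComponent_zero]
      · rw [pderiv_homogeneousComponent 0]
        simp [MvPolynomial.homogeneousComponent_zero]
    · refine le_sup_right (a := parabolic.toSubmodule) (b := Submodule.span ℂ _) ?_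
      refine Submodule.subset_span ⟨n - 2, Subtype.ext ?_⟩
      change ⁅(euler : W2), component n x.1⁆ = (((n - 2 : ℕ) : ℂ) + 1) • component n x.1
      rw [euler_lie_component]
      congr 1
      rw [Nat.cast_sub hn]
      push_cast
      ring
  obtain ⟨N, hN⟩ := exists_sum_component x.1
  have hsum : x = ∑ n ∈ Finset.range N, c n := by
    refine Subtype.ext (hN.trans ?_)
    exact (map_sum S2bar.incl c (Finset.range N)).symm
  rw [hsum]
  exact Submodule.sum_mem _ fun n _ => hc n

/-! ### Quotients and simplicity of Lie modules -/

section LieModule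

variable {L M M' : Type*} [LieRing L] [LieAlgebra ℂ L]
  [AddCommGroup M] [Module ℂ M] [LieRingModule L M] [LieModule ℂ L M]
  [AddCommGroup M'] [Module ℂ M'] [LieRingModule L M'] [LieModule ℂ L M']

theorem nonempty_quotient_ker_equiv (φ : M →ₗ⁅ℂ,L⁆ M') (hφ : Function.Surjective φ) :
    Nonempty ((M ⧸ φ.ker) ≃ₗ⁅ℂ,L⁆ M') := by
  let e : (M ⧸ φ.ker) ≃ₗ[ℂ] M' := (φ : M →ₗ[ℂ] M').quotKerEquivOfSurjective hφ
  have he : ∀ m, e (LieSubmodule.Quotient.mk' φ.ker m) = φ m := fun m => rfl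
  refine ⟨{ e with map_lie' := ?_ }⟩
  intro x m
  obtain ⟨m, rfl⟩ := LieSubmodule.Quotient.surjective_mk' φ.ker m
  change e ⁅x, LieSubmodule.Quotient.mk' φ.ker m⁆ = ⁅x, e (LieSubmodule.Quotient.mk' φ.ker m)⁆
  rw [← LieModuleHom.map_lie, he, he, LieModuleHom.map_lie]

theorem isCoatom_of_isIrreducible_quotient {N : LieSubmodule ℂ L M}
    (h : LieModule.IsIrreducible ℂ L (M ⧸ N)) : IsCoatom N := by
  have hnt := LieModule.nontrivial_of_isIrreducible ℂ L (M ⧸ N)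
  refine ⟨?_, fun K hK => ?_⟩
  · rintro rfl
    obtain ⟨a, ha⟩ := exists_ne (0 : M ⧸ (⊤ : LieSubmodule ℂ L M))
    obtain ⟨m, rfl⟩ := LieSubmodule.Quotient.surjective_mk' _ a
    exact ha ((LieSubmodule.Quotient.mk_eq_zero _).mpr trivial)
  · rcases eq_bot_or_eq_top (K.map (LieSubmodule.Quotient.mk' N)) with h1 | h1
    · exact absurd ((LieSubmodule.Quotient.map_mk'_eq_bot_le _ _).mp h1) hK.not_ge
    · refine eq_top_iff.mpr fun m _ => ?_
      have h2 : LieSubmodule.Quotient.mk' N m ∈ K.map (LieSubmodule.Quotient.mk' N) := by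
        rw [h1]; trivial
      obtain ⟨k, hk, hkm⟩ := (LieSubmodule.mem_map _).mp h2
      have h3 : m - k ∈ N := by
        rw [← LieSubmodule.Quotient.mk_eq_zero, map_sub, hkm, sub_self]
      simpa using K.add_mem (hK.le h3) hk

theorem isIrreducible_of_equiv (e : M ≃ₗ⁅ℂ,L⁆ M') (h : LieModule.IsIrreducible ℂ L M') :
    LieModule.IsIrreducible ℂ L M := by
  have hnt := LieModule.nontrivial_of_isIrreducible ℂ L M'
  have : Nontrivial M := e.toEquiv.nontrivial
  refine LieModule.IsIrreducible.mk fun N hN => ?_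
  rcases eq_bot_or_eq_top (N.map e.toLieModuleHom) with h1 | h1
  · refine absurd ((LieSubmodule.eq_bot_iff _).mpr fun n hn => ?_) hN
    have h2 : e n ∈ N.map e.toLieModuleHom := (LieSubmodule.mem_map _).mpr ⟨n, hn, rfl⟩
    rw [h1, LieSubmodule.mem_bot] at h2
    exact e.injective (h2.trans (map_zero e.toLieModuleHom).symm)
  · refine eq_top_iff.mpr fun m _ => ?_
    have h2 : e m ∈ N.map e.toLieModuleHom := by rw [h1]; trivial
    obtain ⟨k, hk, hkm⟩ := (LieSubmodule.mem_map _).mp h2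
    rwa [← e.injective hkm]

theorem isIrreducible_of_isAtom {N : LieSubmodule ℂ L M} (hN : IsAtom N) :
    LieModule.IsIrreducible ℂ L N := by
  have : Nontrivial N := (LieSubmodule.nontrivial_iff_ne_bot ℂ L M).mpr hN.1
  refine LieModule.IsIrreducible.mk fun K hK => ?_
  have hle : K.map N.incl ≤ N := by
    intro m hm
    obtain ⟨k, -, rfl⟩ := (LieSubmodule.mem_map _).mp hm
    exact k.2
  have hne : K.map N.incl ≠ ⊥ := by
    intro h
    refine hK ((LieSubmodule.eq_bot_iff _).mpr fun k hk => ?_)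
    have h2 : N.incl k ∈ K.map N.incl := (LieSubmodule.mem_map _).mpr ⟨k, hk, rfl⟩
    rw [h, LieSubmodule.mem_bot] at h2
    exact Subtype.ext h2
  have heq : K.map N.incl = N := (hN.le_iff.mp hle).resolve_left hne
  refine eq_top_iff.mpr fun m _ => ?_
  have h2 : (m : M) ∈ K.map N.incl := by rw [heq]; exact m.2
  obtain ⟨k, hk, hkm⟩ := (LieSubmodule.mem_map _).mp h2
  rwa [← Subtype.ext (a1 := k) (a2 := m) hkm]

theorem aeval_toEnd_mem (N : LieSubmodule ℂ L M) (x : L) (q : Polynomial ℂ) {m : M} (hm : m ∈ N) :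
    Polynomial.aeval (LieModule.toEnd ℂ L M x) q m ∈ N := by
  induction q using Polynomial.induction_on generalizing m with
  | C a => simpa [Algebra.algebraMap_eq_smul_one] using N.smul_mem a hm
  | add p q hp hq => simpa using N.add_mem (hp hm) (hq hm)
  | monomial n a h =>
    rw [pow_succ, ← mul_assoc, map_mul, Polynomial.aeval_X, Module.End.mul_apply]
    exact h (N.lie_mem hm)

end LieModule

/-! ### Modules generated by a simple `gl₂`-module killed by `Δ₂` -/

variable {V : Type*} [AddCommGroup V] [Module ℂ V] [LieRingModule gl2 V] [LieModule ℂ gl2 V]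
  {M : Type*} [AddCommGroup M] [Module ℂ M] [LieRingModule S2bar M] [LieModule ℂ S2bar M]

/-- On a simple finite-dimensional `gl₂`-module the identity matrix acts as a scalar. -/
theorem exists_one_lie_eq_smul [FiniteDimensional ℂ V] [LieModule.IsIrreducible ℂ gl2 V] :
    ∃ c : ℂ, ∀ v : V, ⁅(1 : gl2), v⁆ = c • v := by
  have := LieModule.nontrivial_of_isIrreducible ℂ gl2 V
  obtain ⟨c, hc⟩ := Module.End.exists_eigenvalue (LieModule.toEnd ℂ gl2 V 1)
  obtain ⟨v, hv⟩ := hc.exists_hasEigenvector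
  -- The identity matrix is central, so its eigenspaces are `gl₂`-stable.
  let E : LieSubmodule ℂ gl2 V :=
    { Module.End.eigenspace (LieModule.toEnd ℂ gl2 V 1) c with
      lie_mem := by
        intro x m hm
        have h1 : ⁅(1 : gl2), m⁆ = c • m := Module.End.mem_eigenspace_iff.mp hm
        refine Module.End.mem_eigenspace_iff.mpr ?_
        rw [LieModule.toEnd_apply_apply, leibniz_lie, h1, lie_smul]
        simp [LieRing.of_associative_ring_bracket] }
  have hE : E = ⊤ := (eq_bot_or_eq_top E).resolve_left fun h => hv.2 <| by
    have : v ∈ E := hv.1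
    rwa [h, LieSubmodule.mem_bot] at this
  refine ⟨c, fun w => ?_⟩
  have : w ∈ E := by rw [hE]; trivial
  exact Module.End.mem_eigenspace_iff.mp this

/-- `f : V → M` is compatible with the parabolic subalgebra `Δ₂ ⊕ S̄₂(0)`, whose action on `V`
is inflated from `gl₂`. -/
def IsParabolicMap (f : V →ₗ[ℂ] M) : Prop :=
  ∀ (x : parabolic) (v : V), ⁅(x : S2bar), f v⁆ = f ⁅levi x, v⁆

theorem isParabolicMap_of (f : V →ₗ[ℂ] M) (h1 : ∀ i v, ⁅del i, f v⁆ = 0)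
    (h2 : ∀ a v, ⁅linear a, f v⁆ = f ⁅a, v⁆) : IsParabolicMap f := by
  intro x v
  obtain ⟨b, hb⟩ := parabolic_eq x
  rw [hb]
  simp [Fin.sum_univ_two, h1, h2]

variable {f : V →ₗ[ℂ] M}

theorem IsParabolicMap.lie_linear (hf : IsParabolicMap f) (a : gl2) (v : V) :
    ⁅linear a, f v⁆ = f ⁅a, v⁆ := by
  have h := hf ⟨linear a, linear_mem_parabolic a⟩ v
  rwa [levi_linear] at h

/-- A Lie submodule meeting the image of a simple `V` contains it. -/
theorem IsParabolicMap.lieSpan_le (hf : IsParabolicMap f) [LieModule.IsIrreducible ℂ gl2 V]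
    {N : LieSubmodule ℂ S2bar M} {v : V} (hv : f v ∈ N) (h0 : v ≠ 0) :
    LieSubmodule.lieSpan ℂ S2bar (Set.range f) ≤ N := by
  let K : LieSubmodule ℂ gl2 V :=
    { N.toSubmodule.comap f with
      lie_mem := by
        intro a w hw
        change f ⁅a, w⁆ ∈ N
        rw [← hf.lie_linear]
        exact N.lie_mem hw }
  have hK : K = ⊤ := (eq_bot_or_eq_top K).resolve_left fun h => h0 <| by
    have : v ∈ K := hv
    rwa [h, LieSubmodule.mem_bot] at this
  rw [LieSubmodule.lieSpan_le]
  rintro _ ⟨w, rfl⟩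
  have : w ∈ K := by rw [hK]; trivial
  exact this

/-- The vectors obtained from the image of `f` by repeatedly applying eigenvectors of the Euler
field of positive degree. -/
inductive Raised (f : V →ₗ[ℂ] M) : M → Prop
  | base (v : V) : Raised f (f v)
  | raise (n : ℕ) (y : S2bar) (hy : ⁅euler, y⁆ = ((n : ℂ) + 1) • y) (m : M) (hm : Raised f m) :
      Raised f ⁅y, m⁆

/-- The sum of the eigenspaces of the Euler field with eigenvalues `c + 1, c + 2, …`. -/
noncomputable def upper (M : Type*) [AddCommGroup M] [Module ℂ M] [LieRingModule S2bar M]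
    [LieModule ℂ S2bar M] (c : ℂ) : Submodule ℂ M :=
  ⨆ n : ℕ, Module.End.eigenspace (LieModule.toEnd ℂ S2bar M euler) (c + (n + 1))

/-- Positive eigenvectors raise by definition, so only affine `x` matter. In `x y m = [x, y] m + y x
m` both terms reduce to the shorter vector `m`. The induction runs over all `x` in `S̄₂` because
`[x, y]` need not be affine. -/
theorem IsParabolicMap.lie_mem_span_raised (hf : IsParabolicMap f) {m : M} (hm : Raised f m) :
    ∀ x : S2bar, ⁅x, m⁆ ∈ Submodule.span ℂ {m | Raised f m} := by
  have split : ∀ {m : M}, Raised f m →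
      (∀ x ∈ parabolic, ⁅x, m⁆ ∈ Submodule.span ℂ {m | Raised f m}) →
      ∀ x : S2bar, ⁅x, m⁆ ∈ Submodule.span ℂ {m | Raised f m} := by
    intro m hm hp x
    obtain ⟨x0, hx0, x1, hx1, rfl⟩ := Submodule.mem_sup.mp (S2bar_eq_parabolic_sup x)
    rw [add_lie]
    refine Submodule.add_mem _ (hp x0 hx0) ?_
    induction hx1 using Submodule.span_induction with
    | mem y hy =>
      obtain ⟨n, hn⟩ := hy
      exact Submodule.subset_span (.raise n y hn m hm)
    | zero => simp
    | add y z _ _ hy hz => rw [add_lie]; exact Submodule.add_mem _ hy hz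
    | smul a y _ hy => rw [smul_lie]; exact Submodule.smul_mem _ a hy
  induction hm with
  | base v =>
    refine split (.base v) fun x hx => ?_
    rw [hf ⟨x, hx⟩ v]
    exact Submodule.subset_span (.base _)
  | raise n y hy m hm ih =>
    refine split (.raise n y hy m hm) fun x _ => ?_
    rw [leibniz_lie]
    refine Submodule.add_mem _ (ih _) ?_
    have hx := ih x
    generalize ⁅x, m⁆ = w at hx
    induction hx using Submodule.span_induction with
    | mem z hz => exact Submodule.subset_span (.raise n y hy z hz)
    | zero => simp
    | add z w _ _ hz hw => rw [lie_add]; exact Submodule.add_mem _ hz hw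
    | smul a z _ hz => rw [lie_smul]; exact Submodule.smul_mem _ a hz

/-- Each raising adds at least 1 to the Euler eigenvalue, so only unraised vectors stay at `c`. -/
theorem IsParabolicMap.raised_cases (hf : IsParabolicMap f) {c : ℂ}
    (hc : ∀ v : V, ⁅(1 : gl2), v⁆ = c • v) {m : M} (hm : Raised f m) :
    ∃ n : ℕ, ⁅euler, m⁆ = (c + n) • m ∧ (n = 0 → m ∈ LinearMap.range f) := by
  induction hm with
  | base v => exact ⟨0, by rw [euler, hf.lie_linear, hc]; simp, fun _ => ⟨v, rfl⟩⟩
  | raise n y hy m _ ih =>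
    obtain ⟨k, hk, -⟩ := ih
    refine ⟨k + n + 1, ?_, by omega⟩
    rw [leibniz_lie, hy, hk, smul_lie, lie_smul, ← add_smul]
    congr 1
    push_cast
    ring

theorem IsParabolicMap.range_sup_upper (hf : IsParabolicMap f) {c : ℂ}
    (hc : ∀ v : V, ⁅(1 : gl2), v⁆ = c • v)
    (hgen : LieSubmodule.lieSpan ℂ S2bar (Set.range f) = ⊤) :
    LinearMap.range f ⊔ upper M c = ⊤ := by
  let G : LieSubmodule ℂ S2bar M :=
    { Submodule.span ℂ {m | Raised f m} with
      lie_mem := by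
        intro x m hm
        change m ∈ Submodule.span ℂ {m | Raised f m} at hm
        change ⁅x, m⁆ ∈ Submodule.span ℂ {m | Raised f m}
        induction hm using Submodule.span_induction with
        | mem z hz => exact hf.lie_mem_span_raised hz x
        | zero => simp
        | add z w _ _ hz hw => rw [lie_add]; exact Submodule.add_mem _ hz hw
        | smul a z _ hz => rw [lie_smul]; exact Submodule.smul_mem _ a hz }
  have hG : G = ⊤ := by
    rw [eq_top_iff, ← hgen, LieSubmodule.lieSpan_le]
    rintro _ ⟨v, rfl⟩
    exact Submodule.subset_span (.base v)
  rw [eq_top_iff]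
  intro m _
  have hm : m ∈ Submodule.span ℂ {m | Raised f m} := by
    change m ∈ G
    rw [hG]; trivial
  refine Submodule.span_le.mpr (fun z hz => ?_) hm
  obtain ⟨n, hn, h0⟩ := hf.raised_cases hc hz
  rcases n with _ | n
  · exact Submodule.mem_sup_left (h0 rfl)
  · refine Submodule.mem_sup_right (Submodule.mem_iSup_of_mem n ?_)
    rw [Module.End.mem_eigenspace_iff, LieModule.toEnd_apply_apply, hn]
    push_cast
    rfl

/-- A polynomial in the Euler field kills a given vector of `upper M c` and not the eigenspace
with eigenvalue `c`. -/
theorem exists_aeval_eq_zero_of_mem_upper {c : ℂ} {p : M} (hp : p ∈ upper M c) :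
    ∃ q : Polynomial ℂ, q.eval c ≠ 0 ∧
      Polynomial.aeval (LieModule.toEnd ℂ S2bar M euler) q p = 0 := by
  induction hp using Submodule.iSup_induction' with
  | mem n x hx =>
    refine ⟨Polynomial.X - Polynomial.C (c + (n + 1)), ?_, ?_⟩
    · have h : (Polynomial.X - Polynomial.C (c + (n + 1))).eval c = -((n : ℂ) + 1) := by
        simp
      rw [h, neg_ne_zero]
      exact Nat.cast_add_one_ne_zero n
    · rw [Module.End.mem_eigenspace_iff] at hx
      rw [map_sub, Polynomial.aeval_X, Polynomial.aeval_C, LinearMap.sub_apply, hx,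
        Module.algebraMap_end_apply, sub_self]
  | zero => exact ⟨1, by simp, by simp⟩
  | add x y _ _ hx hy =>
    obtain ⟨q, hq, hqx⟩ := hx
    obtain ⟨r, hr, hry⟩ := hy
    refine ⟨q * r, by simp [hq, hr], ?_⟩
    rw [map_add, map_mul, Module.End.mul_apply, Module.End.mul_apply, hry, map_zero, add_zero,
      ← Module.End.mul_apply, ← map_mul, mul_comm, map_mul, Module.End.mul_apply, hqx, map_zero]

theorem IsParabolicMap.aeval_euler (hf : IsParabolicMap f) {c : ℂ}
    (hc : ∀ v : V, ⁅(1 : gl2), v⁆ = c • v) (q : Polynomial ℂ) (v : V) :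
    Polynomial.aeval (LieModule.toEnd ℂ S2bar M euler) q (f v) = q.eval c • f v := by
  have h : LieModule.toEnd ℂ S2bar M euler (f v) = c • f v := by
    rw [LieModule.toEnd_apply_apply, euler, hf.lie_linear, hc, map_smul]
  induction q using Polynomial.induction_on with
  | C a => simp [Algebra.algebraMap_eq_smul_one]
  | add p q hp hq => simp [hp, hq, add_smul]
  | monomial n a ih =>
    rw [pow_succ, ← mul_assoc, map_mul, Polynomial.aeval_X, Module.End.mul_apply, h, map_smul, ih,
      smul_smul, Polynomial.eval_mul_X, mul_comm]

/-- For `f v + p` in `N` with `p` in `upper M c`, a polynomial in the Euler field kills `p` and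
multiplies `f v` by a nonzero scalar. Thus `f v ∈ N`, and `v ≠ 0` would make `N` everything. -/
theorem IsParabolicMap.le_upper (hf : IsParabolicMap f) [LieModule.IsIrreducible ℂ gl2 V] {c : ℂ}
    (hc : ∀ v : V, ⁅(1 : gl2), v⁆ = c • v)
    (hgen : LieSubmodule.lieSpan ℂ S2bar (Set.range f) = ⊤)
    {N : LieSubmodule ℂ S2bar M} (hN : N ≠ ⊤) : N.toSubmodule ≤ upper M c := by
  intro m hm
  have hm' : m ∈ LinearMap.range f ⊔ upper M c := by rw [hf.range_sup_upper hc hgen]; trivial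
  obtain ⟨_, ⟨v, rfl⟩, p, hp, rfl⟩ := Submodule.mem_sup.mp hm'
  obtain ⟨q, hq, hqp⟩ := exists_aeval_eq_zero_of_mem_upper hp
  have h1 := aeval_toEnd_mem N euler q hm
  rw [map_add, hqp, add_zero, hf.aeval_euler hc] at h1
  have h2 : f v ∈ N := by
    have := N.smul_mem (q.eval c)⁻¹ h1
    rwa [smul_smul, inv_mul_cancel₀ hq, one_smul] at this
  have h3 : v = 0 := by
    by_contra h0
    exact hN (eq_top_iff.mpr (hgen ▸ hf.lieSpan_le h2 h0))
  simpa [h3] using hp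

/-- Otherwise each `f v` would be killed by a polynomial in the Euler field not vanishing at `c`;
then `f = 0` generates nothing. -/
theorem IsParabolicMap.upper_ne_top (hf : IsParabolicMap f) [Nontrivial M] {c : ℂ}
    (hc : ∀ v : V, ⁅(1 : gl2), v⁆ = c • v)
    (hgen : LieSubmodule.lieSpan ℂ S2bar (Set.range f) = ⊤) : upper M c ≠ ⊤ := by
  intro h
  have h0 : ∀ v, f v = 0 := fun v => by
    obtain ⟨q, hq, hqv⟩ := exists_aeval_eq_zero_of_mem_upper (c := c) (p := f v) (by rw [h]; trivial)
    rw [hf.aeval_euler hc] at hqv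
    exact (smul_eq_zero.mp hqv).resolve_left hq
  have : LieSubmodule.lieSpan ℂ S2bar (Set.range f) ≤ ⊥ := by
    rw [LieSubmodule.lieSpan_le]
    rintro _ ⟨v, rfl⟩
    simp [h0]
  rw [hgen] at this
  obtain ⟨m, hm⟩ := exists_ne (0 : M)
  exact hm (by simpa using this (LieSubmodule.mem_top m))

/-- A module generated by a simple finite-dimensional `gl₂`-module killed by `Δ₂` has at most one
maximal submodule. -/
theorem IsParabolicMap.isCoatom_unique (hf : IsParabolicMap f) [FiniteDimensional ℂ V]
    [LieModule.IsIrreducible ℂ gl2 V]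
    (hgen : LieSubmodule.lieSpan ℂ S2bar (Set.range f) = ⊤)
    {N N' : LieSubmodule ℂ S2bar M} (hN : IsCoatom N) (hN' : IsCoatom N') : N = N' := by
  obtain ⟨c, hc⟩ := exists_one_lie_eq_smul (V := V)
  have hnt : Nontrivial M := by
    by_contra h
    rw [not_nontrivial_iff_subsingleton] at h
    exact hN.1 (Subsingleton.elim _ _)
  -- Both submodules lie in one proper subspace, so their sum is still proper and maximality makes
  -- it equal to each.
  have h1 : (N ⊔ N').toSubmodule ≤ upper M c := by
    rw [LieSubmodule.sup_toSubmodule]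
    exact sup_le (hf.le_upper hc hgen hN.1) (hf.le_upper hc hgen hN'.1)
  have h2 : N ⊔ N' ≠ ⊤ := fun h => hf.upper_ne_top hc hgen <| by
    rw [h] at h1
    simpa using h1
  have h3 : N ⊔ N' = N := by
    by_contra hne
    exact h2 (hN.2 _ (lt_of_le_of_ne le_sup_left (Ne.symm hne)))
  have h4 : N ⊔ N' = N' := by
    by_contra hne
    exact h2 (hN'.2 _ (lt_of_le_of_ne le_sup_right (Ne.symm hne)))
  exact h3.symm.trans h4

/-! ### The enveloping algebra and the parabolic Verma module -/

/-- The universal property lifts `ι`, viewed as a map into `S`, to `U(S̄₂) → S`; followed by the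
inclusion it is the identity, since it is so on `ι`. -/
theorem US2_subalgebra_eq_top (S : Subalgebra ℂ US2)
    (h : ∀ x : S2bar, UniversalEnvelopingAlgebra.ι ℂ x ∈ S) : S = ⊤ := by
  let g : S2bar →ₗ⁅ℂ⁆ S :=
    { toFun := fun x => ⟨UniversalEnvelopingAlgebra.ι ℂ x, h x⟩
      map_add' := fun x y => Subtype.ext (map_add _ x y)
      map_smul' := fun a x => Subtype.ext (map_smul _ a x)
      map_lie' := fun {x y} => Subtype.ext (by
        change UniversalEnvelopingAlgebra.ι ℂ ⁅x, y⁆ = ⁅UniversalEnvelopingAlgebra.ι ℂ x,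
          UniversalEnvelopingAlgebra.ι ℂ y⁆
        exact LieHom.map_lie _ x y) }
  have hid : S.val.comp (UniversalEnvelopingAlgebra.lift ℂ g) = AlgHom.id ℂ US2 := by
    apply UniversalEnvelopingAlgebra.hom_ext
    refine LieHom.ext fun x => ?_
    change ((UniversalEnvelopingAlgebra.lift ℂ g (UniversalEnvelopingAlgebra.ι ℂ x) : S) : US2)
      = UniversalEnvelopingAlgebra.ι ℂ x
    rw [UniversalEnvelopingAlgebra.lift_ι_apply]
    rfl
  refine eq_top_iff.mpr fun u _ => ?_
  have hu : ((UniversalEnvelopingAlgebra.lift ℂ g u : S) : US2) = u :=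
    congrArg (fun φ : US2 →ₐ[ℂ] US2 => φ u) hid
  rw [← hu]
  exact (UniversalEnvelopingAlgebra.lift ℂ g u).2

section Verma

variable (V : Type u) [AddCommGroup V] [Module ℂ V] [LieRingModule gl2 V] [LieModule ℂ gl2 V]

/-- The quotient map `U(S̄₂) ⊗ V → P(V)`. -/
noncomputable def vermaMk : (US2 ⊗[ℂ] V) →ₗ[US2] ParabolicVerma V := (vermaRel V).mkQ

theorem vermaMk_surjective : Function.Surjective (vermaMk V) := Submodule.mkQ_surjective _

/-- The canonical map `v ↦ 1 ⊗ v` from `V` to `P(V)`. -/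
noncomputable def vermaMap : V →ₗ[ℂ] ParabolicVerma V :=
  ((vermaMk V).restrictScalars ℂ).comp (TensorProduct.mk ℂ US2 V 1)

theorem smul_vermaMap (u : US2) (v : V) : u • vermaMap V v = vermaMk V (u ⊗ₜ v) := by
  change u • vermaMk V (1 ⊗ₜ v) = _
  rw [← map_smul, TensorProduct.smul_tmul', smul_eq_mul, mul_one]

theorem verma_lie (x : S2bar) (m : ParabolicVerma V) :
    ⁅x, m⁆ = UniversalEnvelopingAlgebra.ι ℂ x • m := rfl

theorem isParabolicMap_vermaMap : IsParabolicMap (vermaMap V) := by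
  intro x v
  rw [verma_lie, smul_vermaMap]
  change vermaMk V _ = vermaMk V (1 ⊗ₜ ⁅levi x, v⁆)
  rw [← sub_eq_zero, ← map_sub]
  exact (Submodule.Quotient.mk_eq_zero _).mpr (Submodule.subset_span ⟨x, v, rfl⟩)

/-- The elements preserving `N` form a subalgebra containing `S̄₂`. -/
theorem verma_smul_mem (N : LieSubmodule ℂ S2bar (ParabolicVerma V)) (u : US2)
    {m : ParabolicVerma V} (hm : m ∈ N) : u • m ∈ N := by
  let S : Subalgebra ℂ US2 :=
    { carrier := {u | ∀ m ∈ N, u • m ∈ N}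
      mul_mem' := fun {a b} ha hb m hm => by rw [mul_smul]; exact ha _ (hb _ hm)
      add_mem' := fun {a b} ha hb m hm => by rw [add_smul]; exact N.add_mem (ha _ hm) (hb _ hm)
      algebraMap_mem' := fun c m hm => by rw [algebraMap_smul]; exact N.smul_mem c hm }
  have hS : S = ⊤ := US2_subalgebra_eq_top S fun x m hm => N.lie_mem (x := x) hm
  have hu : u ∈ S := by rw [hS]; trivial
  exact hu m hm

theorem lieSpan_vermaMap :
    LieSubmodule.lieSpan ℂ S2bar (Set.range (vermaMap V)) = ⊤ := by
  refine eq_top_iff.mpr fun m _ => ?_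
  obtain ⟨w, rfl⟩ := vermaMk_surjective V m
  induction w using TensorProduct.induction_on with
  | zero => rw [map_zero]; exact zero_mem _
  | tmul u v =>
    rw [← smul_vermaMap]
    exact verma_smul_mem V _ u (LieSubmodule.subset_lieSpan ⟨v, rfl⟩)
  | add x y hx hy => rw [map_add]; exact add_mem (hx trivial) (hy trivial)

variable {V}

/-- The universal property of the parabolic Verma module. -/
theorem IsParabolicMap.exists_lift {M : Type*} [AddCommGroup M] [Module ℂ M]
    [LieRingModule S2bar M] [LieModule ℂ S2bar M] {f : V →ₗ[ℂ] M} (hf : IsParabolicMap f) :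
    ∃ φ : ParabolicVerma V →ₗ⁅ℂ,S2bar⁆ M, ∀ v, φ (vermaMap V v) = f v := by
  let act : US2 →ₐ[ℂ] Module.End ℂ M :=
    UniversalEnvelopingAlgebra.lift ℂ (LieModule.toEnd ℂ S2bar M)
  let _ : Module US2 M := Module.compHom M act.toRingHom
  have hact : ∀ (u : US2) (m : M), u • m = act u m := fun _ _ => rfl
  have hι : ∀ (x : S2bar) (m : M), UniversalEnvelopingAlgebra.ι ℂ x • m = ⁅x, m⁆ := by
    intro x m
    rw [hact, UniversalEnvelopingAlgebra.lift_ι_apply, LieModule.toEnd_apply_apply]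
  have : IsScalarTower ℂ US2 M := ⟨fun c u m => by
    rw [hact, hact, map_smul, LinearMap.smul_apply]⟩
  let g : (US2 ⊗[ℂ] V) →ₗ[US2] M :=
    TensorProduct.AlgebraTensorModule.lift
      { toFun := fun u => u • f
        map_add' := fun a b => add_smul a b f
        map_smul' := fun a b => mul_smul a b f }
  have hg : ∀ (u : US2) (v : V), g (u ⊗ₜ v) = u • f v := fun _ _ => rfl
  have hker : vermaRel V ≤ LinearMap.ker g := by
    refine Submodule.span_le.mpr ?_
    rintro _ ⟨x, v, rfl⟩
    change g _ = 0
    rw [map_sub, hg, hg, one_smul, hι, hf, sub_self]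
  let h : ParabolicVerma V →ₗ[US2] M := (vermaRel V).liftQ g hker
  refine ⟨{ h.restrictScalars ℂ with map_lie' := fun {x m} => ?_ }, fun v => ?_⟩
  · change h (UniversalEnvelopingAlgebra.ι ℂ x • m) = ⁅x, h m⁆
    rw [map_smul, hι]
  · change g (1 ⊗ₜ v) = f v
    rw [hg, one_smul]

end Verma

/-! ### Vectors killed by `Δ₂` from local nilpotency -/

section LocallyNilpotent

variable {M : Type*} [AddCommGroup M] [Module ℂ M] [LieRingModule S2bar M] [LieModule ℂ S2bar M]

theorem exists_ne_zero_of_ne_bot {N : LieSubmodule ℂ S2bar M} (hN : N ≠ ⊥) :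
    ∃ m ∈ N, m ≠ 0 := by
  by_contra! h
  exact hN ((LieSubmodule.eq_bot_iff N).mpr h)

/-- Take the last nonzero iterate under `del 0`, then under `del 1`. The two operators commute, so
the second stage stays in the kernel of the first. -/
theorem exists_del_eq_zero {N : LieSubmodule ℂ S2bar M} (hN : N ≠ ⊥)
    (h : ∀ (i : Fin 2) (m : M), ∃ k : ℕ, (LieModule.toEnd ℂ S2bar M (del i) ^ k) m = 0) :
    ∃ m ∈ N, m ≠ 0 ∧ ∀ i, ⁅del i, m⁆ = 0 := by
  have step : ∀ (i : Fin 2) (m : M), m ≠ 0 → ∃ k : ℕ,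
      (LieModule.toEnd ℂ S2bar M (del i) ^ k) m ≠ 0 ∧
      ⁅del i, (LieModule.toEnd ℂ S2bar M (del i) ^ k) m⁆ = 0 := by
    classical
    intro i m hm
    have hk := Nat.find_spec (h i m)
    obtain ⟨n, hn⟩ : ∃ n, Nat.find (h i m) = n + 1 :=
      Nat.exists_eq_succ_of_ne_zero fun h0 => hm (by rw [h0] at hk; simpa using hk)
    refine ⟨n, Nat.find_min (h i m) (by omega), ?_⟩
    rw [hn, pow_succ', Module.End.mul_apply] at hk
    exact hk
  have hpow : ∀ (i : Fin 2) (k : ℕ), ∀ m ∈ N, (LieModule.toEnd ℂ S2bar M (del i) ^ k) m ∈ N := by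
    intro i k m hm
    simpa using aeval_toEnd_mem N (del i) (Polynomial.X ^ k) hm
  obtain ⟨m, hmN, hm⟩ := exists_ne_zero_of_ne_bot hN
  obtain ⟨k, hk, hk0⟩ := step 0 m hm
  obtain ⟨l, hl, hl1⟩ := step 1 _ hk
  refine ⟨_, hpow 1 l _ (hpow 0 k m hmN), hl, fun i => ?_⟩
  fin_cases i
  · have hcomm : Commute (LieModule.toEnd ℂ S2bar M (del 0)) (LieModule.toEnd ℂ S2bar M (del 1)) := by
      rw [commute_iff_lie_eq, ← LieHom.map_lie, del_lie_del, map_zero]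
    have := congrArg (fun φ : Module.End ℂ M => φ ((LieModule.toEnd ℂ S2bar M (del 0) ^ k) m))
      (hcomm.pow_right l).eq
    simp only [Module.End.mul_apply, LieModule.toEnd_apply_apply] at this
    change ⁅del 0, _⁆ = _
    rw [this, hk0, map_zero]
  · exact hl1

end LocallyNilpotent

/-- By Leibniz, `∂ᵢ(p tⱼ)` is `∂ᵢ(p) tⱼ` plus `p` or `0`. The extra term is already killed, and `∂ᵢ
p` needs one derivative fewer. -/
theorem pderiv_pow_mul_X (i j : Fin 2) (n : ℕ) (p : A2)
    (h : ((MvPolynomial.pderiv i : W2) : A2 →ₗ[ℂ] A2)^[n] p = 0) :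
    ((MvPolynomial.pderiv i : W2) : A2 →ₗ[ℂ] A2)^[n + 1] (p * MvPolynomial.X j) = 0 := by
  induction n generalizing p with
  | zero =>
    rw [Function.iterate_zero, id] at h
    simp [h]
  | succ n ih =>
    have hadd : ∀ (k : ℕ) (a b : A2), ((MvPolynomial.pderiv i : W2) : A2 →ₗ[ℂ] A2)^[k] (a + b)
        = ((MvPolynomial.pderiv i : W2) : A2 →ₗ[ℂ] A2)^[k] a
          + ((MvPolynomial.pderiv i : W2) : A2 →ₗ[ℂ] A2)^[k] b := fun k a b => by
      simp only [← Module.End.pow_apply, map_add]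
    have hsmul : ∀ (k : ℕ) (c : ℂ) (b : A2),
        ((MvPolynomial.pderiv i : W2) : A2 →ₗ[ℂ] A2)^[k] (c • b)
        = c • ((MvPolynomial.pderiv i : W2) : A2 →ₗ[ℂ] A2)^[k] b := fun k a b => by
      simp only [← Module.End.pow_apply, map_smul]
    have hX : ((MvPolynomial.pderiv i : W2) : A2 →ₗ[ℂ] A2) (p * MvPolynomial.X j)
        = MvPolynomial.pderiv i p * MvPolynomial.X j + (if i = j then (1 : ℂ) else 0) • p := by
      fin_cases i <;> fin_cases j <;> simp [MvPolynomial.pderiv_X] <;> ring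
    rw [Function.iterate_succ_apply, hX, hadd, hsmul, h, smul_zero, add_zero]
    exact ih _ h

theorem exists_pderiv_pow_eq_zero (i : Fin 2) (p : A2) :
    ∃ n, (((MvPolynomial.pderiv i : W2) : A2 →ₗ[ℂ] A2) ^ n) p = 0 := by
  induction p using MvPolynomial.induction_on with
  | C a => exact ⟨1, by simp⟩
  | add p q hp hq =>
    obtain ⟨n, hn⟩ := hp
    obtain ⟨m, hm⟩ := hq
    exact ⟨m + n, by
      rw [map_add, Module.End.pow_map_zero_of_le (Nat.le_add_left n m) hn,
        Module.End.pow_map_zero_of_le (Nat.le_add_right m n) hm, add_zero]⟩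
  | mul_X p j hp =>
    obtain ⟨n, hn⟩ := hp
    rw [Module.End.pow_apply] at hn
    exact ⟨n + 1, by rw [Module.End.pow_apply]; exact pderiv_pow_mul_X i j n p hn⟩

/-! ### Simplicity of `T₁(A₂, V)` -/

section Tensor

variable (V : Type u) [AddCommGroup V] [Module ℂ V] [LieRingModule gl2 V] [LieModule ℂ gl2 V]

theorem tensorAct_del (i : Fin 2) (w : A2 ⊗[ℂ] V) :
    tensorAct V (del i : W2) w
      = (((MvPolynomial.pderiv i : W2) : A2 →ₗ[ℂ] A2).rTensor V) w := by
  induction w using TensorProduct.induction_on with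
  | zero => simp
  | tmul p v =>
    rw [tensorAct_tmul, jac_del]
    simp [coe_del]
  | add x y hx hy => simp only [map_add, hx, hy]

theorem T_del_locally_nilpotent (i : Fin 2) (w : T V) :
    ∃ k : ℕ, (LieModule.toEnd ℂ S2bar (T V) (del i) ^ k) w = 0 := by
  have hop : LieModule.toEnd ℂ S2bar (T V) (del i)
      = (((MvPolynomial.pderiv i : W2) : A2 →ₗ[ℂ] A2).rTensor V : Module.End ℂ (A2 ⊗[ℂ] V)) :=
    LinearMap.ext fun w => tensorAct_del V i w
  rw [hop]
  change ∃ k : ℕ, ((((MvPolynomial.pderiv i : W2) : A2 →ₗ[ℂ] A2).rTensor V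
    : Module.End ℂ (A2 ⊗[ℂ] V)) ^ k) (w : A2 ⊗[ℂ] V) = 0
  change A2 ⊗[ℂ] V at w
  induction w using TensorProduct.induction_on with
  | zero => exact ⟨0, map_zero _⟩
  | tmul p v =>
    obtain ⟨n, hn⟩ := exists_pderiv_pow_eq_zero i p
    refine ⟨n, ?_⟩
    rw [LinearMap.rTensor_pow, LinearMap.rTensor_tmul, hn, TensorProduct.zero_tmul]
  | add x y hx hy =>
    obtain ⟨n, hn⟩ := hx
    obtain ⟨m, hm⟩ := hy
    exact ⟨m + n, by
      rw [map_add, Module.End.pow_map_zero_of_le (Nat.le_add_left n m) hn,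
        Module.End.pow_map_zero_of_le (Nat.le_add_right m n) hm, add_zero]⟩

/-- In a basis of `V` the operators act coordinatewise on polynomials, and a polynomial with zero
gradient is constant. -/
theorem eq_one_tmul_of_rTensor_pderiv_eq_zero (w : A2 ⊗[ℂ] V)
    (h : ∀ i, (((MvPolynomial.pderiv i : W2) : A2 →ₗ[ℂ] A2).rTensor V) w = 0) :
    ∃ v : V, w = 1 ⊗ₜ v := by
  classical
  let b := Module.Basis.ofVectorSpace ℂ V
  let e := TensorProduct.equivFinsuppOfBasisRight (M := A2) b
  have hcoord : ∀ i k (w : A2 ⊗[ℂ] V),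
      e ((((MvPolynomial.pderiv i : W2) : A2 →ₗ[ℂ] A2).rTensor V) w) k
        = MvPolynomial.pderiv i (e w k) := by
    intro i k w
    induction w using TensorProduct.induction_on with
    | zero => simp
    | tmul p v =>
      simp [e]
    | add x y hx hy => simp only [map_add, Finsupp.add_apply, hx, hy]
  have hconst : ∀ k, e w k = MvPolynomial.C (MvPolynomial.constantCoeff (e w k)) := fun k =>
    eq_C_of_pderiv_eq_zero fun i => by rw [← hcoord, h]; simp
  let s : _ →₀ ℂ := (e w).mapRange MvPolynomial.constantCoeff (map_zero _)
  refine ⟨b.repr.symm s, e.injective (Finsupp.ext fun k => ?_)⟩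
  rw [TensorProduct.equivFinsuppOfBasisRight_apply_tmul_apply, hconst]
  simp [s, MvPolynomial.smul_eq_C_mul]

/-- The canonical map `v ↦ 1 ⊗ v` from `V` to `T₁(A₂, V)`. -/
noncomputable def tensorMap : V →ₗ[ℂ] T1 V where
  toFun v := ⟨((1 : A2) ⊗ₜ[ℂ] v : A2 ⊗[ℂ] V), LieSubmodule.subset_lieSpan ⟨v, rfl⟩⟩
  map_add' _ _ := Subtype.ext (TensorProduct.tmul_add _ _ _)
  map_smul' _ _ := Subtype.ext (TensorProduct.tmul_smul _ _ _)

theorem isParabolicMap_tensorMap : IsParabolicMap (tensorMap V) := by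
  refine isParabolicMap_of _ (fun i v => Subtype.ext ?_) fun a v => Subtype.ext ?_
  · change tensorAct V (del i : W2) (1 ⊗ₜ v) = 0
    rw [tensorAct_del, LinearMap.rTensor_tmul]
    simp
  · change tensorAct V (linear a : W2) (1 ⊗ₜ v) = 1 ⊗ₜ ⁅a, v⁆
    have ha : ⁅a, v⁆ = ∑ i, ∑ j, a i j • ⁅(Matrix.single i j 1 : gl2), v⁆ := by
      conv_lhs => rw [Matrix.matrix_eq_sum_single a]
      simp only [Fin.sum_univ_two, add_lie, ← smul_lie, Matrix.smul_single, smul_eq_mul, mul_one]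
    rw [tensorAct_tmul, ha]
    simp [coe_linear, jac_linearField, Fin.sum_univ_two, TensorProduct.tmul_add,
      ← MvPolynomial.algebraMap_eq, Algebra.algebraMap_eq_smul_one, TensorProduct.smul_tmul]

/-- Generation holds by definition inside `T V`; this moves it inside `T1 V`. -/
theorem lieSpan_tensorMap :
    LieSubmodule.lieSpan ℂ S2bar (Set.range (tensorMap V)) = ⊤ := by
  set N := LieSubmodule.lieSpan ℂ S2bar (Set.range (tensorMap V)) with hN
  have hle : T1 V ≤ N.map (T1 V).incl := by
    refine LieSubmodule.lieSpan_le.mpr ?_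
    rintro _ ⟨v, rfl⟩
    exact (LieSubmodule.mem_map _).mpr
      ⟨tensorMap V v, LieSubmodule.subset_lieSpan ⟨v, rfl⟩, rfl⟩
  refine eq_top_iff.mpr fun m _ => ?_
  obtain ⟨k, hk, hkm⟩ := (LieSubmodule.mem_map _).mp (hle m.2)
  rwa [← Subtype.ext (a1 := k) (a2 := m) hkm]

theorem tensorMap_injective : Function.Injective (tensorMap V) := by
  intro v w h
  have h1 : ((1 : A2) ⊗ₜ[ℂ] v : A2 ⊗[ℂ] V) = 1 ⊗ₜ w := congrArg Subtype.val h
  -- Evaluating polynomials at the origin recovers `v` from `1 ⊗ v`.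
  have h2 := congrArg (fun z => TensorProduct.lid ℂ V
    ((MvPolynomial.aeval (fun _ : Fin 2 => (0 : ℂ))).toLinearMap.rTensor V z)) h1
  simpa using h2

theorem isIrreducible_T1 [LieModule.IsIrreducible ℂ gl2 V] :
    LieModule.IsIrreducible ℂ S2bar (T1 V) := by
  have := LieModule.nontrivial_of_isIrreducible ℂ gl2 V
  have : Nontrivial (T1 V) := (tensorMap_injective V).nontrivial
  refine LieModule.IsIrreducible.mk fun N hN => ?_
  -- The search for a vector killed by `Δ₂` takes place in `T V`, where local nilpotency and the
  -- description of such vectors are available.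
  have hmap : N.map (T1 V).incl ≠ ⊥ := by
    obtain ⟨n, hn, hn0⟩ := exists_ne_zero_of_ne_bot hN
    have hmem : (T1 V).incl n ∈ N.map (T1 V).incl := (LieSubmodule.mem_map _).mpr ⟨n, hn, rfl⟩
    intro h
    rw [h, LieSubmodule.mem_bot] at hmem
    exact hn0 (Subtype.ext hmem)
  obtain ⟨w, hwN, hw0, hw⟩ := exists_del_eq_zero hmap (T_del_locally_nilpotent V)
  obtain ⟨n, hn, rfl⟩ := (LieSubmodule.mem_map _).mp hwN
  obtain ⟨v, hv⟩ := eq_one_tmul_of_rTensor_pderiv_eq_zero V ((T1 V).incl n) fun i =>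
    (tensorAct_del V i _).symm.trans (hw i)
  have hvn : tensorMap V v = n := Subtype.ext hv.symm
  refine eq_top_iff.mpr ?_
  rw [← lieSpan_tensorMap]
  refine (isParabolicMap_tensorMap V).lieSpan_le (v := v) (by rwa [hvn]) ?_
  rintro rfl
  exact hw0 (by rw [← hvn, map_zero, map_zero])

end Tensor

/-- A simple module generated by a simple `V` killed by `Δ₂` is a quotient of `P(V)` by a
maximal submodule. -/
theorem IsParabolicMap.exists_quotient_equiv {V : Type u} [AddCommGroup V] [Module ℂ V]
    [LieRingModule gl2 V] [LieModule ℂ gl2 V] {M : Type*} [AddCommGroup M] [Module ℂ M]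
    [LieRingModule S2bar M] [LieModule ℂ S2bar M] {f : V →ₗ[ℂ] M} (hf : IsParabolicMap f)
    (hgen : LieSubmodule.lieSpan ℂ S2bar (Set.range f) = ⊤)
    (hirr : LieModule.IsIrreducible ℂ S2bar M) :
    ∃ N : LieSubmodule ℂ S2bar (ParabolicVerma V),
      LieModule.IsIrreducible ℂ S2bar (ParabolicVerma V ⧸ N) ∧
      Nonempty ((ParabolicVerma V ⧸ N) ≃ₗ⁅ℂ,S2bar⁆ M) := by
  obtain ⟨φ, hφ⟩ := hf.exists_lift
  have hrange : φ.range = ⊤ := by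
    rw [eq_top_iff, ← hgen, LieSubmodule.lieSpan_le]
    rintro _ ⟨v, rfl⟩
    exact (LieModuleHom.mem_range φ _).mpr ⟨_, hφ v⟩
  have hsurj : Function.Surjective φ := fun m => by
    have : m ∈ φ.range := by rw [hrange]; trivial
    exact (LieModuleHom.mem_range φ _).mp this
  obtain ⟨e⟩ := nonempty_quotient_ker_equiv φ hsurj
  exact ⟨φ.ker, isIrreducible_of_equiv e hirr, ⟨e⟩⟩

/-! ### The `gl₂`-module of Whittaker vectors -/

section Whittaker

variable (M : Type u) [AddCommGroup M] [Module ℂ M] [LieRingModule S2bar M] [LieModule ℂ S2bar M]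

theorem phi_zero (x : Delta2) : phi 0 x = 0 := by simp [phi]

theorem mem_Wh_zero_iff {m : M} : m ∈ Wh M 0 ↔ ∀ i, ⁅del i, m⁆ = 0 := by
  constructor
  · intro h i
    have := h ⟨del i, Submodule.subset_span ⟨i, rfl⟩⟩
    rwa [phi_zero, zero_smul] at this
  · intro h x
    rw [phi_zero, zero_smul]
    obtain ⟨x, hx⟩ := x
    induction hx using Submodule.span_induction with
    | mem y hy => obtain ⟨i, rfl⟩ := hy; exact h i
    | zero => exact zero_lie m
    | add y z _ _ hy hz => change ⁅y + z, m⁆ = 0; rw [add_lie]; simp_all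
    | smul a y _ hy => change ⁅a • y, m⁆ = 0; rw [smul_lie]; simp_all

/-- Linear fields normalize `Δ₂`, hence preserve the vectors it kills. -/
theorem linear_lie_mem_Wh (a : gl2) {m : M} (hm : m ∈ Wh M 0) : ⁅linear a, m⁆ ∈ Wh M 0 := by
  rw [mem_Wh_zero_iff] at hm ⊢
  intro i
  rw [leibniz_lie, del_lie_linear, hm, lie_zero]
  simp [Fin.sum_univ_two, hm]

/-- The space of Whittaker vectors of type `0` is a `gl₂`-module. -/
noncomputable instance : LieRingModule gl2 (Wh M 0) where
  bracket a m := ⟨⁅linear a, (m : M)⁆, linear_lie_mem_Wh M a m.2⟩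
  add_lie a b m := Subtype.ext (by
    change ⁅linear (a + b), (m : M)⁆ = _
    rw [map_add, add_lie]; rfl)
  lie_add a m n := Subtype.ext (lie_add (linear a) (m : M) (n : M))
  leibniz_lie a b m := Subtype.ext (by
    change _ = ⁅linear ⁅a, b⁆, (m : M)⁆ + _
    rw [LieHom.map_lie]
    exact leibniz_lie (linear a) (linear b) (m : M))

instance : LieModule ℂ gl2 (Wh M 0) where
  smul_lie c a m := Subtype.ext (by
    change ⁅linear (c • a), (m : M)⁆ = _
    rw [map_smul, smul_lie]; rfl)
  lie_smul c a m := Subtype.ext (lie_smul c (linear a) (m : M))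

theorem isParabolicMap_Wh_incl (K : LieSubmodule ℂ gl2 (Wh M 0)) :
    IsParabolicMap ((Wh M 0).subtype.comp K.toSubmodule.subtype : K →ₗ[ℂ] M) :=
  isParabolicMap_of _ (fun i v => (mem_Wh_zero_iff M).mp v.1.2 i) fun _ _ => rfl

theorem nontrivial_Wh [Nontrivial M] (h : IsOfType M 0) : Nontrivial (Wh M 0) := by
  obtain ⟨m, -, hm0, hm⟩ := exists_del_eq_zero (top_ne_bot (α := LieSubmodule ℂ S2bar M)) fun i m => by
    obtain ⟨k, hk⟩ := h m ⟨del i, Submodule.subset_span ⟨i, rfl⟩⟩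
    rw [phi_zero, zero_smul, sub_zero] at hk
    exact ⟨k, hk⟩
  exact ⟨⟨m, (mem_Wh_zero_iff M).mpr hm⟩, 0, fun h0 => hm0 (congrArg Subtype.val h0)⟩

end Whittaker

end WhittakerS2

/-! ### Classification of the simple modules -/

theorem proposition4p1 :
    (∀ (V : Type u) [AddCommGroup V] [Module ℂ V] [LieRingModule WhittakerS2.gl2 V]
      [LieModule ℂ WhittakerS2.gl2 V] [FiniteDimensional ℂ V]
      [LieModule.IsIrreducible ℂ WhittakerS2.gl2 V],
      LieModule.IsIrreducible ℂ WhittakerS2.S2bar (WhittakerS2.T1 V) ∧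
      ∃ N : LieSubmodule ℂ WhittakerS2.S2bar (WhittakerS2.ParabolicVerma V),
        LieModule.IsIrreducible ℂ WhittakerS2.S2bar (WhittakerS2.ParabolicVerma V ⧸ N) ∧
        (∀ N' : LieSubmodule ℂ WhittakerS2.S2bar (WhittakerS2.ParabolicVerma V),
          LieModule.IsIrreducible ℂ WhittakerS2.S2bar (WhittakerS2.ParabolicVerma V ⧸ N') →
            N' = N) ∧
        Nonempty ((WhittakerS2.ParabolicVerma V ⧸ N) ≃ₗ⁅ℂ, WhittakerS2.S2bar⁆
          WhittakerS2.T1 V)) ∧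
    (∀ (M : Type u) [AddCommGroup M] [Module ℂ M] [LieRingModule WhittakerS2.S2bar M]
      [LieModule ℂ WhittakerS2.S2bar M] [LieModule.IsIrreducible ℂ WhittakerS2.S2bar M],
      WhittakerS2.InOmega M 0 →
      ∃ (V : Type u) (_ : AddCommGroup V) (_ : Module ℂ V) (_ : LieRingModule WhittakerS2.gl2 V)
        (_ : LieModule ℂ WhittakerS2.gl2 V),
        FiniteDimensional ℂ V ∧ LieModule.IsIrreducible ℂ WhittakerS2.gl2 V ∧
        Nonempty (M ≃ₗ⁅ℂ, WhittakerS2.S2bar⁆ WhittakerS2.T1 V)) := by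
  open WhittakerS2 in
  have part1 : ∀ (V : Type u) [AddCommGroup V] [Module ℂ V] [LieRingModule gl2 V]
      [LieModule ℂ gl2 V] [FiniteDimensional ℂ V] [LieModule.IsIrreducible ℂ gl2 V],
      LieModule.IsIrreducible ℂ S2bar (T1 V) ∧
      ∃ N : LieSubmodule ℂ S2bar (ParabolicVerma V),
        LieModule.IsIrreducible ℂ S2bar (ParabolicVerma V ⧸ N) ∧
        (∀ N' : LieSubmodule ℂ S2bar (ParabolicVerma V),
          LieModule.IsIrreducible ℂ S2bar (ParabolicVerma V ⧸ N') → N' = N) ∧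
        Nonempty ((ParabolicVerma V ⧸ N) ≃ₗ⁅ℂ, S2bar⁆ T1 V) := by
    intro V _ _ _ _ _ _
    have hT := isIrreducible_T1 V
    obtain ⟨N, hN, he⟩ :=
      (isParabolicMap_tensorMap V).exists_quotient_equiv (lieSpan_tensorMap V) hT
    exact ⟨hT, N, hN, fun N' hN' =>
      (isParabolicMap_vermaMap V).isCoatom_unique (lieSpan_vermaMap V)
        (isCoatom_of_isIrreducible_quotient hN') (isCoatom_of_isIrreducible_quotient hN), he⟩
  refine ⟨part1, ?_⟩
  open WhittakerS2 in
  intro M _ _ _ _ hM hΩ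
  have := hΩ.finiteDimensional
  have := LieModule.nontrivial_of_isIrreducible ℂ S2bar M
  have := nontrivial_Wh M hΩ.isOfType
  -- Finite dimension of the Whittaker space supplies a minimal nonzero `gl₂`-submodule.
  obtain ⟨K, hK, -⟩ := (eq_bot_or_exists_atom_le (⊤ : LieSubmodule ℂ gl2 (Wh M 0))).resolve_left
    top_ne_bot
  have hKirr := isIrreducible_of_isAtom hK
  have hf := isParabolicMap_Wh_incl M K
  have hgen : LieSubmodule.lieSpan ℂ S2bar
      (Set.range ((Wh M 0).subtype.comp K.toSubmodule.subtype : K →ₗ[ℂ] M)) = ⊤ := by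
    obtain ⟨k, hk⟩ := @exists_ne K (LieModule.nontrivial_of_isIrreducible ℂ gl2 K) 0
    refine (eq_bot_or_eq_top _).resolve_left fun h => hk ?_
    have h1 := LieSubmodule.subset_lieSpan (R := ℂ) (L := S2bar) (Set.mem_range_self
      (f := ((Wh M 0).subtype.comp K.toSubmodule.subtype : K →ₗ[ℂ] M)) k)
    rw [h] at h1
    exact Subtype.ext (Subtype.ext h1)
  have hfin : FiniteDimensional ℂ K := inferInstanceAs (FiniteDimensional ℂ K.toSubmodule)
  -- Both `M` and `T1 K` are simple quotients of the same Verma module, so uniqueness forces the two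
  -- kernels to agree.
  obtain ⟨-, N, -, huniq, ⟨e⟩⟩ := part1 K
  obtain ⟨N', hN', ⟨e'⟩⟩ := hf.exists_quotient_equiv hgen hM
  obtain rfl := huniq N' hN'
  exact ⟨K, inferInstance, inferInstance, inferInstance, inferInstance, hfin, hKirr,
    ⟨e'.symm.trans e⟩⟩
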